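/- Let $\mathbb K$ be $\mathbb R$ or $\mathbb C$ and $n\in\mathbb N$. For a Banach space $E$ over $\mathbb K$ let $\mathcal P^n(E)$ be the space of continuous $n$-homogeneous polynomials $P:E\to\mathbb K$, i.e. functions $P(x)=A(x,\dots,x)$ with $A$ a continuous $n$-linear form, which may be taken symmetric and is then unique. A Banach ideal of $n$-homogeneous polynomials is a pair $(\mathcal Q,\|\cdot\|_{\mathcal Q})$ assigning to each Banach space $E$ a linear subspace $\mathcal Q(E)\subseteq\mathcal P^n(E)$ with a complete norm $\|\cdot\|_{\mathcal Q(E)}$ such that (a) if $T:E_1\to E$ is bounded linear and $P\in\mathcal Q(E)$, then $P\circ T\in\mathcal Q(E_1)$ and $\|P\circ T\|_{\mathcal Q(E_1)}\le\|P\|_{\mathcal Q(E)}\|T\|^n$; (b) $z\mapsto z^n$ belongs to $\mathcal Q(\mathbb K)$ and has norm $1$. An operator is approximable if it is an operator-norm limit of finite rank operators. The ideal $\mathcal Q$ is called minimal if, for every Banach space $E$, a function $P:E\to\mathbb K$ belongs to $\mathcal Q(E)$ if and only if $P=R\circ T$ for some Banach space $F$, some approximable $T:E\to F$ and some $R\in\mathcal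 Q(F)$, and in that case $\|P\|_{\mathcal Q(E)}=\inf\|R\|_{\mathcal Q(F)}\|T\|^n$, the infimum being taken over all such factorizations. For $P\in\mathcal P^n(E)$ with associated symmetric form $A$, the Aron–Berner extension $AB(P):E''\to\mathbb K$ is $AB(P)(z)=\overline A(z,\dots,z)$, where $\overline A$ is obtained from $A$ by extending the variables to $E''$ one at a time, from the last to the first, by weak-star continuity, i.e. $$\overline A(z_1,\dots,z_n)=\lim_{x_1\to z_1}\cdots\lim_{x_n\to z_n}A(x_1,\dots,x_n)$$ with iterated weak-star limits, $x_j\in E$. **Corollary 3.8.** Let $\mathcal Q$ be a minimal Banach ideal of $n$-homogeneous polynomials and $E$ a Banach space. If $P\in\mathcal Q(E)$, then $AB(P)\in\mathcal Q(E'')$ and $$\|AB(P)\|_{\mathcal Q(E'')}=\|P\|_{\mathcal Q(E)}.$$ -/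

import Mathlib

universe u v

namespace PolyIdeals

section Polynomials

variable (𝕜 : Type v) [RCLike 𝕜] (n : ℕ)
variable (E : Type u) [NormedAddCommGroup E] [NormedSpace 𝕜 E]

/-- The space of continuous scalar-valued `n`-homogeneous polynomials on `E`: the functions
`x ↦ A (x, …, x)` with `A` a continuous `n`-linear form on `E`. -/
def HomPoly : Submodule 𝕜 (E → 𝕜) where
  carrier := {P | ∃ A : ContinuousMultilinearMap 𝕜 (fun _ : Fin n => E) 𝕜,
    ∀ x, P x = A (fun _ => x)}
  add_mem' := by
    rintro P Q ⟨A, hA⟩ ⟨B, hB⟩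
    exact ⟨A + B, fun x => by simp [hA, hB]⟩
  zero_mem' := ⟨0, fun x => by simp⟩
  smul_mem' := by
    rintro c P ⟨A, hA⟩
    exact ⟨c • A, fun x => by simp [hA]⟩

variable {𝕜 n E}

/-- `A` is a symmetric continuous `n`-linear form whose restriction to the diagonal is `P`. -/
def IsAssociatedForm (P : E → 𝕜) (A : ContinuousMultilinearMap 𝕜 (fun _ : Fin n => E) 𝕜) :
    Prop :=
  (∀ (σ : Equiv.Perm (Fin n)) (x : Fin n → E), A (fun i => x (σ i)) = A x) ∧
    ∀ x, P x = A (fun _ => x)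

theorem exists_associatedForm {P : E → 𝕜} (hP : P ∈ HomPoly 𝕜 n E) :
    ∃ A : ContinuousMultilinearMap 𝕜 (fun _ : Fin n => E) 𝕜, IsAssociatedForm P A := by
  obtain ⟨A, hA⟩ := hP
  have key : ∀ x : Fin n → E, (((n.factorial : 𝕜)⁻¹ •
      ∑ σ : Equiv.Perm (Fin n), A.domDomCongr σ :
        ContinuousMultilinearMap 𝕜 (fun _ : Fin n => E) 𝕜) x) =
      (n.factorial : 𝕜)⁻¹ * ∑ σ : Equiv.Perm (Fin n), A (fun i => x (σ i)) := by
    intro x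
    simp
  refine ⟨(n.factorial : 𝕜)⁻¹ • ∑ σ : Equiv.Perm (Fin n), A.domDomCongr σ, ?_, ?_⟩
  · intro τ x
    rw [key, key]
    congr 1
    exact Fintype.sum_equiv (Equiv.mulLeft τ) _ _ (fun σ => by simp)
  · intro x
    rw [key, hA]
    have hn : (n.factorial : 𝕜) ≠ 0 := Nat.cast_ne_zero.mpr n.factorial_ne_zero
    simp [Fintype.card_perm, hn]

/-- The symmetric continuous `n`-linear form associated with a polynomial. (It is unique, by
the polarization formula.) -/
noncomputable def associatedForm {P : E → 𝕜} (hP : P ∈ HomPoly 𝕜 n E) :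
    ContinuousMultilinearMap 𝕜 (fun _ : Fin n => E) 𝕜 :=
  (exists_associatedForm hP).choose

theorem associatedForm_spec {P : E → 𝕜} (hP : P ∈ HomPoly 𝕜 n E) :
    IsAssociatedForm P (associatedForm hP) :=
  (exists_associatedForm hP).choose_spec

end Polynomials

section AronBerner

variable {𝕜 : Type v} [RCLike 𝕜] {E : Type u} [NormedAddCommGroup E] [NormedSpace 𝕜 E]

/-- The (iterated) Aron–Berner extension of an `n`-linear form to the bidual, from the last
variable to the first: the bidual element `z n` is applied to the functional
`x ↦ A (x₁, …, x₍ₙ₋₁₎, x)`, which leaves an `(n-1)`-linear form on `E`, and so on. Equivalently, it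
is the iterated weak-star limit `lim_{x₁ → z₁} ⋯ lim_{xₙ → zₙ} A (x₁, …, xₙ)`. -/
noncomputable def multilinearAB : (n : ℕ) →
    ContinuousMultilinearMap 𝕜 (fun _ : Fin n => E) 𝕜 →
    (Fin n → StrongDual 𝕜 (StrongDual 𝕜 E)) → 𝕜
  | 0, A, _ => A Fin.elim0
  | n + 1, A, z =>
      multilinearAB n ((z (Fin.last n)).compContinuousMultilinearMap A.curryRight) (Fin.init z)

/-- The Aron–Berner extension `AB(P) : E'' → 𝕜` of a continuous `n`-homogeneous polynomial. -/
noncomputable def aronBerner {n : ℕ} {P : E → 𝕜} (hP : P ∈ HomPoly 𝕜 n E) :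
    StrongDual 𝕜 (StrongDual 𝕜 E) → 𝕜 :=
  fun z => multilinearAB n (associatedForm hP) (fun _ => z)

end AronBerner

/-- A bounded operator is approximable if it is an operator-norm limit of finite rank
operators. -/
def IsApproximable {𝕜 : Type v} [RCLike 𝕜] {E F : Type u}
    [NormedAddCommGroup E] [NormedSpace 𝕜 E] [NormedAddCommGroup F] [NormedSpace 𝕜 F]
    (T : E →L[𝕜] F) : Prop :=
  T ∈ closure {S : E →L[𝕜] F | FiniteDimensional 𝕜 (LinearMap.range (S : E →ₗ[𝕜] F))}

/-- A Banach ideal of continuous scalar-valued `n`-homogeneous polynomials over the class of all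
Banach spaces (in the universe `u`) over `𝕜`. The value of `nrm E` matters only on
`space E`. -/
structure PolyIdeal (𝕜 : Type) [RCLike 𝕜] (n : ℕ) where
  /-- the component on the Banach space `E` -/
  space : ∀ (E : Type u) [NormedAddCommGroup E] [NormedSpace 𝕜 E] [CompleteSpace E],
    Submodule 𝕜 (E → 𝕜)
  /-- the ideal norm on the component -/
  nrm : ∀ (E : Type u) [NormedAddCommGroup E] [NormedSpace 𝕜 E] [CompleteSpace E],
    (E → 𝕜) → ℝ
  space_le : ∀ (E : Type u) [NormedAddCommGroup E] [NormedSpace 𝕜 E] [CompleteSpace E],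
    space E ≤ HomPoly 𝕜 n E
  nrm_nonneg : ∀ (E : Type u) [NormedAddCommGroup E] [NormedSpace 𝕜 E] [CompleteSpace E],
    ∀ P ∈ space E, 0 ≤ nrm E P
  nrm_add_le : ∀ (E : Type u) [NormedAddCommGroup E] [NormedSpace 𝕜 E] [CompleteSpace E],
    ∀ P ∈ space E, ∀ Q ∈ space E, nrm E (P + Q) ≤ nrm E P + nrm E Q
  nrm_smul : ∀ (E : Type u) [NormedAddCommGroup E] [NormedSpace 𝕜 E] [CompleteSpace E],
    ∀ (c : 𝕜), ∀ P ∈ space E, nrm E (c • P) = ‖c‖ * nrm E P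
  eq_zero_of_nrm : ∀ (E : Type u) [NormedAddCommGroup E] [NormedSpace 𝕜 E] [CompleteSpace E],
    ∀ P ∈ space E, nrm E P = 0 → P = 0
  /-- every component is complete for its ideal norm -/
  complete : ∀ (E : Type u) [NormedAddCommGroup E] [NormedSpace 𝕜 E] [CompleteSpace E],
    ∀ f : ℕ → E → 𝕜, (∀ k, f k ∈ space E) →
      (∀ ε > 0, ∃ N, ∀ k ≥ N, ∀ l ≥ N, nrm E (f k - f l) < ε) →
      ∃ P ∈ space E, ∀ ε > 0, ∃ N, ∀ k ≥ N, nrm E (f k - P) < ε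
  comp_mem : ∀ (E₁ E : Type u) [NormedAddCommGroup E₁] [NormedSpace 𝕜 E₁] [CompleteSpace E₁]
    [NormedAddCommGroup E] [NormedSpace 𝕜 E] [CompleteSpace E] (T : E₁ →L[𝕜] E),
    ∀ P ∈ space E, P ∘ T ∈ space E₁
  nrm_comp_le : ∀ (E₁ E : Type u) [NormedAddCommGroup E₁] [NormedSpace 𝕜 E₁] [CompleteSpace E₁]
    [NormedAddCommGroup E] [NormedSpace 𝕜 E] [CompleteSpace E] (T : E₁ →L[𝕜] E),
    ∀ P ∈ space E, nrm E₁ (P ∘ T) ≤ nrm E P * ‖T‖ ^ n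
  /-- `z ↦ zⁿ` belongs to the component on the scalar field (lifted to the universe `u`) … -/
  pow_mem : (fun z : ULift.{u} 𝕜 => z.down ^ n) ∈ space (ULift.{u} 𝕜)
  /-- … and has norm one. -/
  nrm_pow : nrm (ULift.{u} 𝕜) (fun z : ULift.{u} 𝕜 => z.down ^ n) = 1

namespace PolyIdeal

variable {𝕜 : Type} [RCLike 𝕜] {n : ℕ}

/-- The set of all numbers `‖R‖_{𝒬(F)} ‖T‖ⁿ` where `P = R ∘ T` is a factorization through a Banach
space `F` with `T : E → F` approximable and `R ∈ 𝒬(F)`. -/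
def factorNorms (𝒬 : PolyIdeal.{u} 𝕜 n) (E : Type u) [NormedAddCommGroup E] [NormedSpace 𝕜 E]
    (P : E → 𝕜) : Set ℝ :=
  {r | ∃ (F : Type u) (_ : NormedAddCommGroup F) (_ : NormedSpace 𝕜 F) (_ : CompleteSpace F)
    (T : E →L[𝕜] F) (R : F → 𝕜),
    IsApproximable T ∧ R ∈ 𝒬.space F ∧ P = R ∘ T ∧ r = 𝒬.nrm F R * ‖T‖ ^ n}

/-- `P` belongs to the minimal kernel `𝒬^min = 𝒬 ∘ 𝔉̄` iff it admits such a factorization. -/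
def MemMin (𝒬 : PolyIdeal.{u} 𝕜 n) (E : Type u) [NormedAddCommGroup E] [NormedSpace 𝕜 E]
    (P : E → 𝕜) : Prop :=
  (𝒬.factorNorms E P).Nonempty

/-- The norm of the minimal kernel: the infimum of `‖R‖_{𝒬(F)} ‖T‖ⁿ` over all factorizations. -/
noncomputable def minNorm (𝒬 : PolyIdeal.{u} 𝕜 n) (E : Type u) [NormedAddCommGroup E]
    [NormedSpace 𝕜 E] (P : E → 𝕜) : ℝ :=
  sInf (𝒬.factorNorms E P)

/-- `𝒬` is minimal if it coincides, with equality of norms, with its minimal kernel. -/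
def IsMinimal (𝒬 : PolyIdeal.{u} 𝕜 n) : Prop :=
  ∀ (E : Type u) [NormedAddCommGroup E] [NormedSpace 𝕜 E] [CompleteSpace E] (P : E → 𝕜),
    (P ∈ 𝒬.space E ↔ 𝒬.MemMin E P) ∧ (P ∈ 𝒬.space E → 𝒬.nrm E P = 𝒬.minNorm E P)

end PolyIdeal

end PolyIdeals

/-! By minimality `P = R ∘ T` with `T : E → F` approximable. The bitranspose of a finite rank
operator takes its values in the canonical copy of `F` in `F''`, and this survives norm limits
because that copy is closed. So `T` yields `U : E'' → F` with `‖U‖ ≤ ‖T‖`, and `AB(P) = R ∘ U`: each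
weak-star extension step merely evaluates at a point of `F`. The ideal property and the infimum over
factorizations give `≤`. Conversely, `AB(P)` restricts to `P` along the canonical embedding `E →
E''`, which has norm at most one. -/

namespace PolyIdeals

section AssociatedForm

variable {𝕜 : Type v} [RCLike 𝕜] {n : ℕ} {E : Type u} [NormedAddCommGroup E] [NormedSpace 𝕜 E]

/-- The polarization formula: the associated form of a polynomial is unique. -/
theorem IsAssociatedForm.eq {P : E → 𝕜}
    {A B : ContinuousMultilinearMap 𝕜 (fun _ : Fin n => E) 𝕜}
    (hA : IsAssociatedForm P A) (hB : IsAssociatedForm P B) : A = B := by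
  -- The `n`-th derivative at `0` of `x ↦ C (x, …, x)` sums `C` over all permutations of its
  -- arguments; symmetry turns this into `n! C`.
  have key : ∀ {C : ContinuousMultilinearMap 𝕜 (fun _ : Fin n => E) 𝕜},
      IsAssociatedForm P C → ∀ v, iteratedFDeriv 𝕜 n P 0 v = (n.factorial : 𝕜) * C v := by
    intro C hC v
    have hPC : P = fun x => C (fun _ => x) := funext hC.2
    rw [hPC, C.iteratedFDeriv_comp_diagonal 0 v]
    simp [hC.1, Fintype.card_perm]
  ext v
  have hn : (n.factorial : 𝕜) ≠ 0 := Nat.cast_ne_zero.mpr n.factorial_ne_zero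
  exact mul_left_cancel₀ hn ((key hA v).symm.trans (key hB v))

theorem IsAssociatedForm.comp {F : Type u} [NormedAddCommGroup F] [NormedSpace 𝕜 F]
    {R : F → 𝕜} {B : ContinuousMultilinearMap 𝕜 (fun _ : Fin n => F) 𝕜}
    (hB : IsAssociatedForm R B) (T : E →L[𝕜] F) :
    IsAssociatedForm (R ∘ T) (B.compContinuousLinearMap fun _ => T) :=
  ⟨fun σ x => hB.1 σ fun i => T (x i), fun x => hB.2 (T x)⟩

end AssociatedForm

section AronBerner

set_option maxSynthPendingDepth 3

variable {𝕜 : Type v} [RCLike 𝕜] {E F : Type u} [NormedAddCommGroup E] [NormedSpace 𝕜 E]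
  [NormedAddCommGroup F] [NormedSpace 𝕜 F]

/-- If the bitranspose of `T : E → F` maps each `z i` to a point `w i` of `F`, then the extension of
`B ∘ (T, …, T)` takes at `z` the value `B w`. -/
theorem multilinearAB_compContinuousLinearMap (T : E →L[𝕜] F) {n : ℕ}
    (B : ContinuousMultilinearMap 𝕜 (fun _ : Fin n => F) 𝕜)
    (z : Fin n → StrongDual 𝕜 (StrongDual 𝕜 E)) (w : Fin n → F)
    (h : ∀ i (φ : StrongDual 𝕜 F), z i (φ ∘L T) = φ (w i)) :
    multilinearAB n (B.compContinuousLinearMap fun _ => T) z = B w := by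
  induction n with
  | zero =>
    rw [multilinearAB, ContinuousMultilinearMap.compContinuousLinearMap_apply]
    exact congrArg B (Subsingleton.elim _ _)
  | succ n ih =>
    -- With the other variables frozen, the form is a functional composed with `T`, on which `z
    -- (Fin.last n)` acts as evaluation at `w (Fin.last n)`. What remains is again a form composed
    -- with `T`, so the induction continues.
    have hform : (z (Fin.last n)).compContinuousMultilinearMap
          (B.compContinuousLinearMap fun _ => T).curryRight =
        ((NormedSpace.inclusionInDoubleDual 𝕜 F
          (w (Fin.last n))).compContinuousMultilinearMap
            B.curryRight).compContinuousLinearMap fun _ => T := by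
      ext m
      have hm : (B.compContinuousLinearMap fun _ => T).curryRight m =
          (B.curryRight fun i => T (m i)) ∘L T := by
        ext x
        simp only [ContinuousMultilinearMap.curryRight_apply,
          ContinuousMultilinearMap.compContinuousLinearMap_apply,
          ContinuousLinearMap.comp_apply]
        congr 1
        ext i
        refine Fin.lastCases ?_ (fun j => ?_) i <;> simp
      simp only [ContinuousLinearMap.compContinuousMultilinearMap_coe, Function.comp_apply,
        ContinuousMultilinearMap.compContinuousLinearMap_apply,
        NormedSpace.dual_def]
      rw [hm, h]
    rw [multilinearAB, hform, ih _ (Fin.init z) (Fin.init w) fun i φ => h i.castSucc φ]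
    simp [Fin.snoc_init_self]

/-- The case `T = id`: canonical images of points act on functionals by evaluation. -/
theorem aronBerner_inclusionInDoubleDual {n : ℕ} {P : E → 𝕜} (hP : P ∈ HomPoly 𝕜 n E) (x : E) :
    aronBerner hP (NormedSpace.inclusionInDoubleDual 𝕜 E x) = P x := by
  have h := multilinearAB_compContinuousLinearMap (ContinuousLinearMap.id 𝕜 E)
    (associatedForm hP) (fun _ => NormedSpace.inclusionInDoubleDual 𝕜 E x) (fun _ => x)
    fun i φ => by simp
  exact h.trans ((associatedForm_spec hP).2 x).symm

/-- If the bitranspose of `T` takes its values in `F`, through `U : E'' → F`, then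
`AB(R ∘ T) = R ∘ U`. -/
theorem aronBerner_comp {n : ℕ} {R : F → 𝕜} (hR : R ∈ HomPoly 𝕜 n F) (T : E →L[𝕜] F)
    (U : StrongDual 𝕜 (StrongDual 𝕜 E) →L[𝕜] F)
    (hU : ∀ z (φ : StrongDual 𝕜 F), z (φ ∘L T) = φ (U z))
    (hP : R ∘ T ∈ HomPoly 𝕜 n E) : aronBerner hP = R ∘ U := by
  -- `associatedForm` is a choice, so uniqueness is what identifies the form of `R ∘ T`.
  have hform := (associatedForm_spec hP).eq ((associatedForm_spec hR).comp T)
  ext z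
  rw [aronBerner, hform, multilinearAB_compContinuousLinearMap T (associatedForm hR) _
    (fun _ => U z) fun _ φ => hU z φ]
  exact ((associatedForm_spec hR).2 (U z)).symm

/-- The bitranspose of a continuous linear map. -/
noncomputable def bitranspose (T : E →L[𝕜] F) :
    StrongDual 𝕜 (StrongDual 𝕜 E) →L[𝕜] StrongDual 𝕜 (StrongDual 𝕜 F) :=
  ContinuousLinearMap.precomp 𝕜 (ContinuousLinearMap.precomp 𝕜 T)

theorem bitranspose_apply (T : E →L[𝕜] F) (z : StrongDual 𝕜 (StrongDual 𝕜 E))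
    (φ : StrongDual 𝕜 F) : bitranspose T z φ = z (φ ∘L T) := rfl

theorem continuous_bitranspose_apply (z : StrongDual 𝕜 (StrongDual 𝕜 E)) :
    Continuous fun T : E →L[𝕜] F => bitranspose T z :=
  ((ContinuousLinearMap.compL 𝕜 (StrongDual 𝕜 F) (StrongDual 𝕜 E) 𝕜 z) ∘L
    (ContinuousLinearMap.compL 𝕜 E F 𝕜).flip).continuous

theorem norm_bitranspose_apply_le (T : E →L[𝕜] F) (z : StrongDual 𝕜 (StrongDual 𝕜 E)) :
    ‖bitranspose T z‖ ≤ ‖T‖ * ‖z‖ := by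
  refine ContinuousLinearMap.opNorm_le_bound _ (by positivity) fun φ => ?_
  calc ‖bitranspose T z φ‖ ≤ ‖z‖ * ‖φ ∘L T‖ := z.le_opNorm _
    _ ≤ ‖z‖ * (‖φ‖ * ‖T‖) := by gcongr; exact φ.opNorm_comp_le T
    _ = ‖T‖ * ‖z‖ * ‖φ‖ := by ring

/-- A basis `b` of the range gives `S = ∑ f i ⊗ b i` with `f i ∈ E'`, so `z` only has to be applied
to the `f i`. -/
theorem bitranspose_mem_range_of_finiteDimensional (S : E →L[𝕜] F)
    (hS : FiniteDimensional 𝕜 (LinearMap.range (S : E →ₗ[𝕜] F)))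
    (z : StrongDual 𝕜 (StrongDual 𝕜 E)) :
    bitranspose S z ∈ Set.range (NormedSpace.inclusionInDoubleDual 𝕜 F) := by
  let b := Module.finBasis 𝕜 (LinearMap.range (S : E →ₗ[𝕜] F))
  let S₀ : E →L[𝕜] LinearMap.range (S : E →ₗ[𝕜] F) :=
    S.codRestrict _ fun x => LinearMap.mem_range_self (S : E →ₗ[𝕜] F) x
  let f := fun i => (LinearMap.toContinuousLinearMap (b.coord i)) ∘L S₀
  refine ⟨∑ i, z (f i) • (b i : F), ?_⟩
  ext φ
  have hφ : φ ∘L S = ∑ i, φ (b i) • f i := by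
    ext x
    have hx : S x = ∑ i, f i x • (b i : F) := by
      refine (congrArg Subtype.val (b.sum_repr (S₀ x))).symm.trans ?_
      rw [Submodule.coe_sum]
      rfl
    simp [hx, mul_comm]
  rw [bitranspose_apply, hφ]
  simp [mul_comm]

/-- The bitranspose of an approximable operator takes its values in the original space. -/
theorem IsApproximable.bitranspose_mem_range [CompleteSpace F] {T : E →L[𝕜] F}
    (hT : IsApproximable T) (z : StrongDual 𝕜 (StrongDual 𝕜 E)) :
    bitranspose T z ∈ Set.range (NormedSpace.inclusionInDoubleDual 𝕜 F) := by
  -- Completeness of `F` enters here: an isometric image of a complete space is closed.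
  have hclosed : IsClosed (Set.range (NormedSpace.inclusionInDoubleDual 𝕜 F)) :=
    (NormedSpace.inclusionInDoubleDualLi 𝕜 (E := F)).isometry.isClosedEmbedding.isClosed_range
  exact closure_minimal (fun S hS => bitranspose_mem_range_of_finiteDimensional S hS z)
    (hclosed.preimage (continuous_bitranspose_apply z)) hT

/-- An approximable operator `E → F` extends, through its bitranspose, to an operator
`E'' → F` of no larger norm. -/
theorem IsApproximable.exists_extension [CompleteSpace F] {T : E →L[𝕜] F}
    (hT : IsApproximable T) :
    ∃ U : StrongDual 𝕜 (StrongDual 𝕜 E) →L[𝕜] F,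
      (∀ z (φ : StrongDual 𝕜 F), z (φ ∘L T) = φ (U z)) ∧ ‖U‖ ≤ ‖T‖ := by
  choose g hg using hT.bitranspose_mem_range
  let J := NormedSpace.inclusionInDoubleDualLi 𝕜 (E := F)
  have hJ : ∀ z, J (g z) = bitranspose T z := hg
  -- The chosen preimages depend linearly on `z` because `J` is injective and the bitranspose is
  -- linear.
  let L : StrongDual 𝕜 (StrongDual 𝕜 E) →ₗ[𝕜] F :=
    { toFun := g
      map_add' := fun z₁ z₂ => J.injective (by simp only [map_add, hJ])
      map_smul' := fun c z => J.injective (by simp only [map_smul, hJ, RingHom.id_apply]) }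
  have hL : ∀ z, ‖L z‖ ≤ ‖T‖ * ‖z‖ := fun z => by
    rw [← J.norm_map]
    exact (congrArg norm (hJ z)).trans_le (norm_bitranspose_apply_le T z)
  refine ⟨L.mkContinuous ‖T‖ hL, fun z φ => ?_, L.mkContinuous_norm_le (norm_nonneg T) hL⟩
  exact (congrArg (fun ψ => ψ φ) (hJ z)).symm

end AronBerner

end PolyIdeals

theorem corollary3p8 {𝕜 : Type} [RCLike 𝕜] {n : ℕ} (𝒬 : PolyIdeals.PolyIdeal.{u} 𝕜 n)
    (h𝒬 : 𝒬.IsMinimal) (E : Type u) [NormedAddCommGroup E] [NormedSpace 𝕜 E] [CompleteSpace E]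
    (P : E → 𝕜) (hP : P ∈ 𝒬.space E) :
    PolyIdeals.aronBerner (𝒬.space_le E hP) ∈ 𝒬.space (StrongDual 𝕜 (StrongDual 𝕜 E)) ∧
      𝒬.nrm (StrongDual 𝕜 (StrongDual 𝕜 E)) (PolyIdeals.aronBerner (𝒬.space_le E hP)) =
        𝒬.nrm E P := by
  have key : ∀ r ∈ 𝒬.factorNorms E P,
      PolyIdeals.aronBerner (𝒬.space_le E hP) ∈ 𝒬.space (StrongDual 𝕜 (StrongDual 𝕜 E)) ∧
        𝒬.nrm (StrongDual 𝕜 (StrongDual 𝕜 E)) (PolyIdeals.aronBerner (𝒬.space_le E hP)) ≤ r := by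
    rintro r ⟨F, _, _, _, T, R, hT, hR, rfl, rfl⟩
    obtain ⟨U, hU, hnorm⟩ := hT.exists_extension
    rw [PolyIdeals.aronBerner_comp (𝒬.space_le F hR) T U hU]
    refine ⟨𝒬.comp_mem (StrongDual 𝕜 (StrongDual 𝕜 E)) F U R hR,
      (𝒬.nrm_comp_le (StrongDual 𝕜 (StrongDual 𝕜 E)) F U R hR).trans ?_⟩
    have := 𝒬.nrm_nonneg F R hR
    gcongr
  obtain ⟨r, hr⟩ : (𝒬.factorNorms E P).Nonempty := (h𝒬 E P).1.1 hP
  have hmem := (key r hr).1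
  refine ⟨hmem, le_antisymm ?_ ?_⟩
  · rw [(h𝒬 E P).2 hP]
    exact le_csInf ⟨r, hr⟩ fun s hs => (key s hs).2
  · have hcomp : PolyIdeals.aronBerner (𝒬.space_le E hP) ∘
        NormedSpace.inclusionInDoubleDual 𝕜 E = P :=
      funext (PolyIdeals.aronBerner_inclusionInDoubleDual (𝒬.space_le E hP))
    have h := 𝒬.nrm_comp_le _ _ (NormedSpace.inclusionInDoubleDual 𝕜 E) _ hmem
    rw [hcomp] at h
    refine h.trans (mul_le_of_le_one_right (𝒬.nrm_nonneg _ _ hmem) ?_)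
    exact pow_le_one₀ (norm_nonneg _) (NormedSpace.inclusionInDoubleDual_norm_le 𝕜 E)
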